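/- Let $n\ge 0$. A combinatorially skew-Hankel tournament of order $n$ is an $n\times n$ $(0,1)$-matrix $T=[t_{ij}]$ such that $t_{ii}=t_{i,n+1-i}=0$ for all $i$, and $t_{ji}=1-t_{ij}$ and $t_{n+1-j,n+1-i}=1-t_{ij}$ whenever $j\ne i$ and $j\ne n+1-i$. Its score vector is the vector of its row sums, and $\mathcal T_{H^*}(R)$ denotes the set of all combinatorially skew-Hankel tournaments with score vector $R$. Write $a\to b$ if $t_{ab}=1$ and $t_{ba}=0$; reversing this arc means replacing $t_{ab}$ by $0$ and $t_{ba}$ by $1$. For distinct indices $i,j,k$ with $i\to j\to k\to i$ in $T$, the 3-cycle switch $\triangle_{i,j,k}$ reverses the three arcs of this cycle and leaves all other entries unchanged. It is pure if $\{i,j,k\}\cap\{n+1-i,n+1-j,n+1-k\}$ is empty or, for $n$ odd, equal to $\{(n+1)/2\}$; its complementary switch is $\triangle^c_{i,j,k}=\triangle_{n+1-i,n+1-j,n+1-k}$. For indices $i,j$ such that $i,j,n+1-i,n+1-j$ are distinct and $i\to j\to n+1-i\to n+1-j\to i$ in $T$, the 4-cycle skew-Hankel switch $\square_{i,j,n+1-i,n+1-j}$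 reverses the four arcs of this cycle and leaves all other entries unchanged. Theorem. Let $T_1,T_2\in\mathcal T_{H^*}(R)$. Then there is a finite (possibly empty) sequence of moves that brings $T_1$ to $T_2$, where each move is either a 4-cycle skew-Hankel switch $\square_{i,j,n+1-i,n+1-j}$ or a pair consisting of a pure 3-cycle switch $\triangle_{i,j,k}$ followed by its complementary switch $\triangle^c_{i,j,k}$, and each move produces a combinatorially skew-Hankel tournament in $\mathcal T_{H^*}(R)$. -/

import Mathlib

/-- Transposition across the Hankel diagonal (the anti-diagonal).  Row and column indices are
`0, …, n - 1`, so that `Fin.rev i` is the index that is written `n + 1 - i` when they are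
numbered `1, …, n`. -/
def hankelTranspose {n : ℕ} (T : Matrix (Fin n) (Fin n) ℤ) : Matrix (Fin n) (Fin n) ℤ :=
  fun i j => T j.rev i.rev

/-- Combinatorially skew-Hankel tournaments: `(0,1)`-matrices with zeros on the main diagonal and on
the Hankel diagonal that, off these two diagonals, are combinatorially skew-symmetric about each of
them. -/
structure IsSkewHankelTournament {n : ℕ} (T : Matrix (Fin n) (Fin n) ℤ) : Prop where
  zero_or_one : ∀ i j, T i j = 0 ∨ T i j = 1
  diag : ∀ i, T i i = 0
  hankelDiag : ∀ i, T i i.rev = 0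
  skew : ∀ i j, j ≠ i → j ≠ i.rev → T.transpose i j = 1 - T i j
  hankelSkew : ∀ i j, j ≠ i → j ≠ i.rev → hankelTranspose T i j = 1 - T i j

/-- The score vector: the vector of row sums. -/
def scoreVector {n : ℕ} (T : Matrix (Fin n) (Fin n) ℤ) : Fin n → ℤ :=
  fun i => ∑ j, T i j

/-- The set of all combinatorially skew-Hankel tournaments with score vector `R`. -/
def skewHankelClass {n : ℕ} (R : Fin n → ℤ) : Set (Matrix (Fin n) (Fin n) ℤ) :=
  {T | IsSkewHankelTournament T ∧ scoreVector T = R}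

/-- The matrix obtained from `T` by reversing the arcs `a → b` with `(a, b) ∈ A`; all other
entries are kept. -/
def reverseArcs {n : ℕ} (T : Matrix (Fin n) (Fin n) ℤ) (A : Finset (Fin n × Fin n)) :
    Matrix (Fin n) (Fin n) ℤ :=
  fun a b => if (a, b) ∈ A then 0 else if (b, a) ∈ A then 1 else T a b

/-- `T'` arises from `T` by the 3-cycle switch at `i, j, k`: `T` has the 3-cycle
`i → j → k → i`, and `T'` is `T` with this cycle reversed. -/
structure IsThreeCycleSwitch {n : ℕ} (i j k : Fin n) (T T' : Matrix (Fin n) (Fin n) ℤ) :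
    Prop where
  distinct : [i, j, k].Nodup
  cycle : ∀ p ∈ ({(i, j), (j, k), (k, i)} : Finset (Fin n × Fin n)),
    T p.1 p.2 = 1 ∧ T p.2 p.1 = 0
  result : T' = reverseArcs T {(i, j), (j, k), (k, i)}

/-- `T'` arises from `T` by the 4-cycle switch at `i, j, k, l`: `T` has the 4-cycle
`i → j → k → l → i`, and `T'` is `T` with this cycle reversed. -/
structure IsFourCycleSwitch {n : ℕ} (i j k l : Fin n) (T T' : Matrix (Fin n) (Fin n) ℤ) :
    Prop where
  distinct : [i, j, k, l].Nodup
  cycle : ∀ p ∈ ({(i, j), (j, k), (k, l), (l, i)} : Finset (Fin n × Fin n)),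
    T p.1 p.2 = 1 ∧ T p.2 p.1 = 0
  result : T' = reverseArcs T {(i, j), (j, k), (k, l), (l, i)}

/-- The 3-cycle switch at `i, j, k` is pure if the index set `{i, j, k}` and the complementary
index set are disjoint or, for odd `n`, have only the middle index in common. -/
def IsPure {n : ℕ} (i j k : Fin n) : Prop :=
  ({i, j, k} : Finset (Fin n)) ∩ {i.rev, j.rev, k.rev} = ∅ ∨
    ∃ m : Fin n, 2 * (m.val + 1) = n + 1 ∧
      ({i, j, k} : Finset (Fin n)) ∩ {i.rev, j.rev, k.rev} = {m}

/-- The moves: a 4-cycle skew-Hankel switch, or a pure 3-cycle switch followed by its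
complementary switch. -/
inductive SkewHankelMove {n : ℕ} : Matrix (Fin n) (Fin n) ℤ → Matrix (Fin n) (Fin n) ℤ → Prop
  | fourCycle (i j : Fin n) (T T' : Matrix (Fin n) (Fin n) ℤ)
      (h : IsFourCycleSwitch i j i.rev j.rev T T') : SkewHankelMove T T'
  | threeCyclePair (i j k : Fin n) (T S T' : Matrix (Fin n) (Fin n) ℤ)
      (hpure : IsPure i j k)
      (h : IsThreeCycleSwitch i j k T S)
      (hc : IsThreeCycleSwitch i.rev j.rev k.rev S T') : SkewHankelMove T T'

/-!
The condition on a combinatorially skew-Hankel tournament `T` says that, away from the two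
diagonals, `T` is a tournament and `Fin.rev` is an automorphism of it.  For two members `T`, `U` of
the same class, call an arc `a → b` of `T` that is reversed in `U` a discrepancy; their number is
`discrepancy T U`.

Suppose that `a → b` is a discrepancy.  As `T` and `U` have equal scores at `b`, there is a
discrepancy `b → c`, and `c ≠ a`.  If `c` is the reverse of `a`, then
`a → b → a.rev → b.rev → a` is a 4-cycle of `T` all of whose arcs are discrepancies, and the
4-cycle switch lowers their number by four (`exists_closer_of_fourCycle`).  Otherwise `a`, `b`, `c`
lie in three different orbits of `Fin.rev`.  If `c → a` in `T`, then the pure 3-cycle switch at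
`a, b, c` and its complement remove four discrepancies and create at most two
(`exists_closer_of_threeCycle`).  If `a → c` in `U`, the same applies with `T` and `U` exchanged.
In the only remaining case `a → c` is itself a discrepancy.

Hence, if no move in `T` or in `U` lowers the number of discrepancies, then the discrepancies form
a transitive irreflexive relation on a finite set in which every arc can be prolonged; such a
relation is empty, so `T = U` (`eq_of_forall_move_le`).  As moves are reversible
(`SkewHankelMove.symm`), the theorem follows by induction on the number of discrepancies.
-/

/-! ### Reversing a set of arcs -/

/-- The change that reversing the arcs in `A` makes to a matrix: `-1` at the pairs in `A`, and `1`
at the reversed pairs. -/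
def reversalChange {n : ℕ} (A : Finset (Fin n × Fin n)) (a b : Fin n) : ℤ :=
  (if (b, a) ∈ A then 1 else 0) - (if (a, b) ∈ A then 1 else 0)

theorem reversalChange_swap {n : ℕ} (A : Finset (Fin n × Fin n)) (a b : Fin n) :
    reversalChange A b a = -reversalChange A a b := by
  simp [reversalChange]

theorem reverseArcs_apply {n : ℕ} {T : Matrix (Fin n) (Fin n) ℤ} {A : Finset (Fin n × Fin n)}
    (hA : ∀ p ∈ A, T p.1 p.2 = 1 ∧ T p.2 p.1 = 0) (a b : Fin n) :
    reverseArcs T A a b = T a b + reversalChange A a b := by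
  unfold reverseArcs reversalChange
  by_cases h₁ : (a, b) ∈ A <;> by_cases h₂ : (b, a) ∈ A
  · have h₃ := (hA _ h₁).1
    have h₄ := (hA _ h₂).2
    simp_all
  · have h₃ := (hA _ h₁).1
    simp_all
  · have h₄ := (hA _ h₂).2
    simp_all
  · simp_all

theorem reverseArcs_zero_or_one {n : ℕ} {T : Matrix (Fin n) (Fin n) ℤ}
    (hT : ∀ i j, T i j = 0 ∨ T i j = 1) (A : Finset (Fin n × Fin n)) (i j : Fin n) :
    reverseArcs T A i j = 0 ∨ reverseArcs T A i j = 1 := by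
  unfold reverseArcs
  split_ifs
  · exact Or.inl rfl
  · exact Or.inr rfl
  · exact hT i j

theorem reverseArcs_swap {n : ℕ} {T : Matrix (Fin n) (Fin n) ℤ} {A B : Finset (Fin n × Fin n)}
    (hA : ∀ p ∈ A, T p.1 p.2 = 1 ∧ T p.2 p.1 = 0) (hB : ∀ a b, (a, b) ∈ B ↔ (b, a) ∈ A) :
    T = reverseArcs (reverseArcs T A) B := by
  ext a b
  have h₁ := hA (a, b)
  have h₂ := hA (b, a)
  simp only [reverseArcs, hB]
  split_ifs <;> simp_all

theorem reverseArcs_arc_swap {n : ℕ} {T : Matrix (Fin n) (Fin n) ℤ}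
    {A B : Finset (Fin n × Fin n)} (hA : ∀ p ∈ A, T p.1 p.2 = 1 ∧ T p.2 p.1 = 0)
    (hB : ∀ a b, (a, b) ∈ B ↔ (b, a) ∈ A) :
    ∀ p ∈ B, reverseArcs T A p.1 p.2 = 1 ∧ reverseArcs T A p.2 p.1 = 0 := by
  rintro ⟨a, b⟩ hp
  rw [hB] at hp
  have h₁ := hA (a, b)
  have h₂ := hA (b, a) hp
  simp only [reverseArcs]
  split_ifs <;> simp_all

theorem sum_reversalChange_mul {n : ℕ} (A : Finset (Fin n × Fin n)) (f : Fin n → Fin n → ℤ) :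
    ∑ a, ∑ b, reversalChange A a b * f a b = ∑ p ∈ A, (f p.2 p.1 - f p.1 p.2) := by
  have h (g : Fin n × Fin n → ℤ) :
      ∑ a, ∑ b, (if (a, b) ∈ A then g (a, b) else 0) = ∑ p ∈ A, g p := by
    rw [← Fintype.sum_prod_type' (f := fun a b => if (a, b) ∈ A then g (a, b) else 0)]
    simp
  simp only [reversalChange, sub_mul, ite_mul, one_mul, zero_mul, Finset.sum_sub_distrib]
  rw [Finset.sum_comm, h (fun p => f p.2 p.1), h (fun p => f p.1 p.2)]

/-- The total change in row `r` is the in-degree minus the out-degree of `r` in `A`. -/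
theorem sum_reversalChange {n : ℕ} (A : Finset (Fin n × Fin n)) (r : Fin n) :
    ∑ b, reversalChange A r b =
      ∑ p ∈ A, ((if p.2 = r then 1 else 0) - (if p.1 = r then 1 else 0)) := by
  rw [← sum_reversalChange_mul A (fun a _ => if a = r then 1 else 0)]
  simp

theorem scoreVector_reverseArcs {n : ℕ} {T : Matrix (Fin n) (Fin n) ℤ}
    {A : Finset (Fin n × Fin n)} (hA : ∀ p ∈ A, T p.1 p.2 = 1 ∧ T p.2 p.1 = 0)
    (h : ∀ r, ∑ b, reversalChange A r b = 0) :
    scoreVector (reverseArcs T A) = scoreVector T := by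
  ext r
  simp [scoreVector, reverseArcs_apply hA, Finset.sum_add_distrib, h]

theorem IsSkewHankelTournament.of_add {n : ℕ} {T T' : Matrix (Fin n) (Fin n) ℤ}
    (hT : IsSkewHankelTournament T) (h01 : ∀ i j, T' i j = 0 ∨ T' i j = 1)
    (E : Fin n → Fin n → ℤ) (hE : ∀ a b, T' a b = T a b + E a b)
    (hskew : ∀ a b, E b a = -E a b) (hrev : ∀ a b, E a.rev b.rev = E a b) :
    IsSkewHankelTournament T' where
  zero_or_one := h01
  diag i := by
    have := hskew i i
    rw [hE, hT.diag]
    omega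
  hankelDiag i := by
    have h₁ := hskew i i.rev
    have h₂ := hrev i i.rev
    rw [Fin.rev_rev] at h₂
    rw [hE, hT.hankelDiag]
    omega
  skew i j h h' := by
    have h₁ := hT.skew i j h h'
    simp only [Matrix.transpose_apply] at h₁ ⊢
    rw [hE, hE, h₁, hskew]
    ring
  hankelSkew i j h h' := by
    have h₁ := hT.hankelSkew i j h h'
    simp only [hankelTranspose] at h₁ ⊢
    rw [hE, hE, h₁, hrev, hskew]
    ring

/-! ### Counting discrepancies -/

/-- The number of arcs of `T` that are reversed in `U`. -/
def discrepancy {n : ℕ} (T U : Matrix (Fin n) (Fin n) ℤ) : ℤ :=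
  ∑ a, ∑ b, T a b * U b a

theorem discrepancy_comm {n : ℕ} (T U : Matrix (Fin n) (Fin n) ℤ) :
    discrepancy T U = discrepancy U T := by
  unfold discrepancy
  rw [Finset.sum_comm]
  simp only [mul_comm]

theorem discrepancy_nonneg {n : ℕ} {T U : Matrix (Fin n) (Fin n) ℤ}
    (hT : IsSkewHankelTournament T) (hU : IsSkewHankelTournament U) : 0 ≤ discrepancy T U := by
  refine Finset.sum_nonneg fun a _ => Finset.sum_nonneg fun b _ => ?_
  rcases hT.zero_or_one a b with h | h <;> rcases hU.zero_or_one b a with h' | h' <;> simp [h, h']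

theorem discrepancy_reverseArcs {n : ℕ} {T : Matrix (Fin n) (Fin n) ℤ}
    (U : Matrix (Fin n) (Fin n) ℤ) {A : Finset (Fin n × Fin n)}
    (hA : ∀ p ∈ A, T p.1 p.2 = 1 ∧ T p.2 p.1 = 0) :
    discrepancy (reverseArcs T A) U = discrepancy T U + ∑ p ∈ A, (U p.1 p.2 - U p.2 p.1) := by
  simp only [discrepancy, reverseArcs_apply hA, add_mul, Finset.sum_add_distrib]
  rw [sum_reversalChange_mul A (fun a b => U b a)]

/-! ### Arcs and the reversal of indices -/

namespace IsSkewHankelTournament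

variable {n : ℕ} {T : Matrix (Fin n) (Fin n) ℤ}

theorem ne_of_arc (hT : IsSkewHankelTournament T) {a b : Fin n} (h : T a b = 1) :
    b ≠ a ∧ b ≠ a.rev := by
  constructor <;> rintro rfl
  · simp [hT.diag] at h
  · simp [hT.hankelDiag] at h

theorem swap (hT : IsSkewHankelTournament T) {a b : Fin n} (h : b ≠ a) (h' : b ≠ a.rev) :
    T b a = 1 - T a b :=
  hT.skew a b h h'

theorem map_rev (hT : IsSkewHankelTournament T) {a b : Fin n} (h : b ≠ a) (h' : b ≠ a.rev) :
    T a.rev b.rev = T a b := by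
  have h₁ := hT.hankelSkew b a h.symm (fun e => h' (by simp [e]))
  have h₂ := hT.swap h h'
  simp only [hankelTranspose] at h₁
  omega

theorem swap_of_arc (hT : IsSkewHankelTournament T) {a b : Fin n} (h : T a b = 1) :
    T b a = 0 := by
  rw [hT.swap (hT.ne_of_arc h).1 (hT.ne_of_arc h).2, h]
  norm_num

theorem rev_arc (hT : IsSkewHankelTournament T) {a b : Fin n} (h : T a b = 1) :
    T a.rev b.rev = 1 := by
  rw [hT.map_rev (hT.ne_of_arc h).1 (hT.ne_of_arc h).2, h]

end IsSkewHankelTournament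

/-- An index fixed by `Fin.rev` is the middle one, so there is at most one. -/
theorem eq_of_rev_eq_self {n : ℕ} {a b : Fin n} (ha : a.rev = a) (hb : b.rev = b) : a = b := by
  rw [Fin.ext_iff] at *
  rw [Fin.val_rev] at *
  omega

/-- A triple of indices none of which is the reverse of another one is pure. -/
theorem isPure_of_ne {n : ℕ} {i j k : Fin n} (hij : j ≠ i.rev) (hjk : k ≠ j.rev)
    (hki : i ≠ k.rev) : IsPure i j k := by
  have hmem (x : Fin n) : x ∈ ({i, j, k} : Finset (Fin n)) ∩ {i.rev, j.rev, k.rev} ↔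
      x ∈ ({i, j, k} : Finset (Fin n)) ∧ x.rev = x := by
    have h₁ : j.rev ≠ i := fun h => hij (by simp [← h])
    have h₂ : k.rev ≠ j := fun h => hjk (by simp [← h])
    have h₃ : i.rev ≠ k := fun h => hki (by simp [← h])
    simp only [Finset.mem_inter, Finset.mem_insert, Finset.mem_singleton]
    grind
  rcases Finset.eq_empty_or_nonempty
    (({i, j, k} : Finset (Fin n)) ∩ {i.rev, j.rev, k.rev}) with h | ⟨m, hm⟩
  · exact Or.inl h
  · have hm' := ((hmem m).1 hm).2
    refine Or.inr ⟨m, ?_, Finset.eq_singleton_iff_unique_mem.2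
      ⟨hm, fun x hx => eq_of_rev_eq_self ((hmem x).1 hx).2 hm'⟩⟩
    have := congrArg Fin.val hm'
    rw [Fin.val_rev] at this
    omega

/-! ### Moves are reversible -/

theorem IsThreeCycleSwitch.symm {n : ℕ} {i j k : Fin n} {T S : Matrix (Fin n) (Fin n) ℤ}
    (h : IsThreeCycleSwitch i j k T S) : IsThreeCycleSwitch i k j S T := by
  have hB (a b : Fin n) : (a, b) ∈ ({(i, k), (k, j), (j, i)} : Finset (Fin n × Fin n)) ↔
      (b, a) ∈ ({(i, j), (j, k), (k, i)} : Finset (Fin n × Fin n)) := by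
    simp only [Finset.mem_insert, Finset.mem_singleton, Prod.mk.injEq]
    tauto
  have hd := h.distinct
  refine ⟨by simp only [List.nodup_cons, List.mem_cons] at hd ⊢; grind, ?_, ?_⟩
  · rw [h.result]
    exact reverseArcs_arc_swap h.cycle hB
  · rw [h.result]
    exact reverseArcs_swap h.cycle hB

theorem IsFourCycleSwitch.symm {n : ℕ} {i j k l : Fin n} {T S : Matrix (Fin n) (Fin n) ℤ}
    (h : IsFourCycleSwitch i j k l T S) : IsFourCycleSwitch j i l k S T := by
  have hB (a b : Fin n) :
      (a, b) ∈ ({(j, i), (i, l), (l, k), (k, j)} : Finset (Fin n × Fin n)) ↔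
        (b, a) ∈ ({(i, j), (j, k), (k, l), (l, i)} : Finset (Fin n × Fin n)) := by
    simp only [Finset.mem_insert, Finset.mem_singleton, Prod.mk.injEq]
    tauto
  have hd := h.distinct
  refine ⟨by simp only [List.nodup_cons, List.mem_cons] at hd ⊢; grind, ?_, ?_⟩
  · rw [h.result]
    exact reverseArcs_arc_swap h.cycle hB
  · rw [h.result]
    exact reverseArcs_swap h.cycle hB

theorem IsPure.rev_swap {n : ℕ} {i j k : Fin n} (h : IsPure i j k) :
    IsPure i.rev k.rev j.rev := by
  unfold IsPure at *
  rwa [Fin.rev_rev, Fin.rev_rev, Fin.rev_rev, Finset.inter_comm, Finset.pair_comm k j,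
    Finset.pair_comm k.rev j.rev]

theorem SkewHankelMove.symm {n : ℕ} {T T' : Matrix (Fin n) (Fin n) ℤ}
    (h : SkewHankelMove T T') : SkewHankelMove T' T := by
  cases h with
  | fourCycle i j _ _ h => exact .fourCycle j i _ _ h.symm
  | threeCyclePair i j k _ S _ hpure h hc =>
    refine .threeCyclePair i.rev k.rev j.rev _ S _ hpure.rev_swap hc.symm ?_
    simpa using h.symm

/-! ### Moves that lower the number of discrepancies -/

theorem exists_closer_of_fourCycle {n : ℕ} {R : Fin n → ℤ} {T U : Matrix (Fin n) (Fin n) ℤ}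
    (hT : T ∈ skewHankelClass R) (hU : U ∈ skewHankelClass R) {i j : Fin n}
    (h₁ : T i j = 1) (h₂ : T j i.rev = 1) (h₁' : U i j = 0) (h₂' : U j i.rev = 0) :
    ∃ T', SkewHankelMove T T' ∧ T' ∈ skewHankelClass R ∧ discrepancy T' U < discrepancy T U := by
  obtain ⟨hT, hR⟩ := hT
  obtain ⟨hU, -⟩ := hU
  have h₃ := hT.rev_arc h₁
  have h₄ := hT.rev_arc h₂
  rw [Fin.rev_rev] at h₄
  obtain ⟨n₁, n₂⟩ := hT.ne_of_arc h₁
  have n₃ : i.rev ≠ i := by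
    rintro h
    rw [h, hT.swap_of_arc h₁] at h₂
    norm_num at h₂
  have n₄ : j.rev ≠ j := by
    rintro h
    rw [h, hT.swap_of_arc h₁] at h₄
    norm_num at h₄
  have n₅ : j.rev ≠ i := fun h => n₂ (by simp [← h])
  have n₆ : i.rev ≠ j.rev := fun h => n₁ (Fin.rev_injective h.symm)
  have hcyc : ∀ p ∈ ({(i, j), (j, i.rev), (i.rev, j.rev), (j.rev, i)} : Finset (Fin n × Fin n)),
      T p.1 p.2 = 1 ∧ T p.2 p.1 = 0 := by
    simp only [Finset.forall_mem_insert, Finset.mem_singleton, forall_eq]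
    exact ⟨⟨h₁, hT.swap_of_arc h₁⟩, ⟨h₂, hT.swap_of_arc h₂⟩, ⟨h₃, hT.swap_of_arc h₃⟩,
      ⟨h₄, hT.swap_of_arc h₄⟩⟩
  refine ⟨_, .fourCycle i j T _ ⟨?_, hcyc, rfl⟩, ⟨?_, ?_⟩, ?_⟩
  · simp only [List.nodup_cons, List.mem_cons]
    grind
  · refine hT.of_add (reverseArcs_zero_or_one hT.zero_or_one _) _ (reverseArcs_apply hcyc)
      (reversalChange_swap _) fun a b => ?_
    simp only [reversalChange, Finset.mem_insert, Finset.mem_singleton, Prod.mk.injEq,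
      Fin.rev_eq_iff, Fin.rev_rev]
    congr 2 <;> grind
  · rw [scoreVector_reverseArcs hcyc, hR]
    intro r
    rw [sum_reversalChange, Finset.sum_insert, Finset.sum_insert, Finset.sum_insert,
      Finset.sum_singleton]
    · ring
    all_goals simp; grind
  · have e₁ := hU.swap n₁ n₂
    have e₂ := hU.swap (a := j) (b := i.rev) n₂.symm n₆
    have e₃ := hU.map_rev n₁ n₂
    have e₄ := hU.map_rev (a := j) (b := i.rev) n₂.symm n₆
    have e₅ := hU.swap (a := i.rev) (b := j.rev) n₆.symm (by simpa using n₅)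
    have e₆ := hU.swap (a := j.rev) (b := i) n₅.symm (by simpa using n₁.symm)
    rw [Fin.rev_rev] at e₄
    rw [discrepancy_reverseArcs U hcyc, Finset.sum_insert, Finset.sum_insert, Finset.sum_insert,
      Finset.sum_singleton]
    · dsimp only
      omega
    all_goals simp; grind

/-- Two of the arcs of the cycle are discrepancies, and so are their images under `Fin.rev`; the
third arc and its image cannot outweigh them. -/
theorem exists_closer_of_threeCycle {n : ℕ} {R : Fin n → ℤ} {T U : Matrix (Fin n) (Fin n) ℤ}
    (hT : T ∈ skewHankelClass R) (hU : U ∈ skewHankelClass R) {i j k : Fin n}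
    (h₁ : T i j = 1) (h₂ : T j k = 1) (h₃ : T k i = 1) (h₁' : U i j = 0) (h₂' : U j k = 0) :
    ∃ T', SkewHankelMove T T' ∧ T' ∈ skewHankelClass R ∧ discrepancy T' U < discrepancy T U := by
  obtain ⟨hT, hR⟩ := hT
  obtain ⟨hU, -⟩ := hU
  obtain ⟨n₁, m₁⟩ := hT.ne_of_arc h₁
  obtain ⟨n₂, m₂⟩ := hT.ne_of_arc h₂
  obtain ⟨n₃, m₃⟩ := hT.ne_of_arc h₃
  have m₁' : i ≠ j.rev := fun h => m₁ (by simp [h])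
  have m₂' : j ≠ k.rev := fun h => m₂ (by simp [h])
  have m₃' : k ≠ i.rev := fun h => m₃ (by simp [h])
  have r₁ : i.rev ≠ j.rev := fun h => n₁ (Fin.rev_injective h.symm)
  have r₂ : j.rev ≠ k.rev := fun h => n₂ (Fin.rev_injective h.symm)
  have r₃ : k.rev ≠ i.rev := fun h => n₃ (Fin.rev_injective h.symm)
  have fixed {a b : Fin n} : a.rev = a → b.rev = b → a = b := eq_of_rev_eq_self
  have fij := @fixed i j
  have fjk := @fixed j k
  have fki := @fixed k i
  have hcyc : ∀ p ∈ ({(i, j), (j, k), (k, i)} : Finset (Fin n × Fin n)),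
      T p.1 p.2 = 1 ∧ T p.2 p.1 = 0 := by
    simp only [Finset.forall_mem_insert, Finset.mem_singleton, forall_eq]
    exact ⟨⟨h₁, hT.swap_of_arc h₁⟩, ⟨h₂, hT.swap_of_arc h₂⟩, ⟨h₃, hT.swap_of_arc h₃⟩⟩
  have hcyc' : ∀ p ∈ ({(i.rev, j.rev), (j.rev, k.rev), (k.rev, i.rev)} : Finset (Fin n × Fin n)),
      T p.1 p.2 = 1 ∧ T p.2 p.1 = 0 := by
    simp only [Finset.forall_mem_insert, Finset.mem_singleton, forall_eq]
    exact ⟨⟨hT.rev_arc h₁, hT.swap_of_arc (hT.rev_arc h₁)⟩,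
      ⟨hT.rev_arc h₂, hT.swap_of_arc (hT.rev_arc h₂)⟩,
      ⟨hT.rev_arc h₃, hT.swap_of_arc (hT.rev_arc h₃)⟩⟩
  set A : Finset (Fin n × Fin n) := {(i, j), (j, k), (k, i)} with hA
  set B : Finset (Fin n × Fin n) := {(i.rev, j.rev), (j.rev, k.rev), (k.rev, i.rev)} with hB
  have hAB (a b : Fin n) : (a.rev, b.rev) ∈ B ↔ (a, b) ∈ A := by simp [hA, hB]
  have hBA (a b : Fin n) : (a.rev, b.rev) ∈ A ↔ (a, b) ∈ B := by
    simp [hA, hB, Fin.rev_eq_iff]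
  -- The first switch leaves the complementary cycle intact.
  have hcycS : ∀ p ∈ B, reverseArcs T A p.1 p.2 = 1 ∧ reverseArcs T A p.2 p.1 = 0 := by
    have hdisj : ∀ p ∈ B, (p.1, p.2) ∉ A ∧ (p.2, p.1) ∉ A := by
      simp only [hA, hB, Finset.mem_insert, Finset.mem_singleton, Prod.mk.injEq]
      grind
    intro p hp
    simp [reverseArcs, hdisj p hp, hcyc' p hp]
  have sumA (f : Fin n × Fin n → ℤ) : ∑ p ∈ A, f p = f (i, j) + (f (j, k) + f (k, i)) := by
    rw [hA, Finset.sum_insert, Finset.sum_insert, Finset.sum_singleton]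
    all_goals simp; grind
  have sumB (f : Fin n × Fin n → ℤ) : ∑ p ∈ B, f p =
      f (i.rev, j.rev) + (f (j.rev, k.rev) + f (k.rev, i.rev)) := by
    rw [hB, Finset.sum_insert, Finset.sum_insert, Finset.sum_singleton]
    all_goals simp; grind
  refine ⟨_, .threeCyclePair i j k T (reverseArcs T A) (reverseArcs (reverseArcs T A) B)
    (isPure_of_ne m₁ m₂ m₃) ⟨?_, hcyc, rfl⟩ ⟨?_, hcycS, rfl⟩, ⟨?_, ?_⟩, ?_⟩
  · simp only [List.nodup_cons, List.mem_cons]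
    grind
  · simp only [List.nodup_cons, List.mem_cons]
    grind
  · refine hT.of_add (reverseArcs_zero_or_one (reverseArcs_zero_or_one hT.zero_or_one _) _)
      (fun a b => reversalChange A a b + reversalChange B a b) (fun a b => ?_) (fun a b => ?_)
      fun a b => ?_
    · rw [reverseArcs_apply hcycS, reverseArcs_apply hcyc, add_assoc]
    · rw [reversalChange_swap A a b, reversalChange_swap B a b]
      ring
    · simp only [reversalChange, hAB, hBA]
      ring
  · rw [scoreVector_reverseArcs hcycS, scoreVector_reverseArcs hcyc, hR]
    · intro r
      rw [sum_reversalChange, sumA]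
      ring
    · intro r
      rw [sum_reversalChange, sumB]
      ring
  · have e₁ := hU.swap n₁ m₁
    have e₂ := hU.swap n₂ m₂
    have e₃ := hU.swap n₃ m₃
    have d₁ := hU.map_rev n₁ m₁
    have d₂ := hU.map_rev n₂ m₂
    have d₃ := hU.map_rev n₃ m₃
    have d₁' := hU.map_rev n₁.symm m₁'
    have d₂' := hU.map_rev n₂.symm m₂'
    have d₃' := hU.map_rev n₃.symm m₃'
    have b := hU.zero_or_one k i
    rw [discrepancy_reverseArcs U hcycS, discrepancy_reverseArcs U hcyc, sumA, sumB]
    dsimp only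
    omega

/-! ### Connectedness -/

/-- If no move in `T` or in `U` lowers the number of discrepancies, there are none. -/
theorem eq_of_forall_move_le {n : ℕ} {R : Fin n → ℤ} {T U : Matrix (Fin n) (Fin n) ℤ}
    (hT : T ∈ skewHankelClass R) (hU : U ∈ skewHankelClass R)
    (hTU : ¬∃ T', SkewHankelMove T T' ∧ T' ∈ skewHankelClass R ∧
      discrepancy T' U < discrepancy T U)
    (hUT : ¬∃ U', SkewHankelMove U U' ∧ U' ∈ skewHankelClass R ∧
      discrepancy U' T < discrepancy U T) : T = U := by
  let P (a b : Fin n) : Prop := T a b = 1 ∧ U a b = 0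
  have swapU {a b : Fin n} (h : P a b) : U b a = 1 := by
    rw [hU.1.swap (hT.1.ne_of_arc h.1).1 (hT.1.ne_of_arc h.1).2, h.2]
    norm_num
  have trans {a b c : Fin n} (hab : P a b) (hbc : P b c) : P a c := by
    have n₁ : c ≠ a := by
      rintro rfl
      have := hT.1.swap_of_arc hab.1
      rw [hbc.1] at this
      norm_num at this
    have n₂ : c ≠ a.rev := by
      rintro rfl
      exact hTU (exists_closer_of_fourCycle hT hU hab.1 hbc.1 hab.2 hbc.2)
    have hTca : T c a ≠ 1 := fun h =>
      hTU (exists_closer_of_threeCycle hT hU hab.1 hbc.1 h hab.2 hbc.2)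
    have hUac : U a c ≠ 1 := fun h =>
      hUT (exists_closer_of_threeCycle hU hT (swapU hbc) (swapU hab) h
        (hT.1.swap_of_arc hbc.1) (hT.1.swap_of_arc hab.1))
    have h₁ := hT.1.swap n₁ n₂
    have h₂ := hT.1.zero_or_one c a
    have h₃ := hU.1.zero_or_one a c
    exact ⟨by omega, by omega⟩
  have succ {a b : Fin n} (hab : P a b) : ∃ c, P b c := by
    by_contra! h
    have hsum : ∑ c, T b c = ∑ c, U b c := congrFun (hT.2.trans hU.2.symm) b
    refine hsum.not_lt (Finset.sum_lt_sum (fun c _ => ?_) ⟨a, Finset.mem_univ a, ?_⟩)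
    · have h₁ := hT.1.zero_or_one b c
      have h₂ := hU.1.zero_or_one b c
      have h₃ : ¬(T b c = 1 ∧ U b c = 0) := h c
      omega
    · rw [swapU hab, hT.1.swap_of_arc hab.1]
      norm_num
  have empty (a b : Fin n) : ¬P a b := by
    intro hab
    have : IsTrans (Fin n) (fun x y => P y x) := ⟨fun _ _ _ h h' => trans h' h⟩
    have : Std.Irrefl (fun x y => P y x) := ⟨fun x (h : P x x) => by simpa [hT.1.diag] using h.1⟩
    obtain ⟨m, ⟨x, hx⟩, hm⟩ := (Finite.wellFounded_of_trans_of_irrefl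
      (fun x y => P y x)).has_min {y | ∃ x, P x y} ⟨b, a, hab⟩
    obtain ⟨y, hy⟩ := succ hx
    exact hm y ⟨m, hy⟩ hy
  ext a b
  by_cases h : b = a
  · rw [h, hT.1.diag, hU.1.diag]
  by_cases h' : b = a.rev
  · rw [h', hT.1.hankelDiag, hU.1.hankelDiag]
  have h₁ := hT.1.swap h h'
  have h₂ := hU.1.swap h h'
  have h₃ := hT.1.zero_or_one a b
  have h₄ := hU.1.zero_or_one a b
  have h₅ : ¬(T a b = 1 ∧ U a b = 0) := empty a b
  have h₆ : ¬(T b a = 1 ∧ U b a = 0) := empty b a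
  omega

theorem mainTheorem8 (n : ℕ) (R : Fin n → ℤ) (T₁ T₂ : Matrix (Fin n) (Fin n) ℤ)
    (h₁ : T₁ ∈ skewHankelClass R) (h₂ : T₂ ∈ skewHankelClass R) :
    Relation.ReflTransGen
      (fun T T' : Matrix (Fin n) (Fin n) ℤ => SkewHankelMove T T' ∧ T' ∈ skewHankelClass R)
      T₁ T₂ := by
  induction hd : (discrepancy T₁ T₂).toNat using Nat.strong_induction_on generalizing T₁ T₂ with
  | _ d ih =>
    by_cases c₁ : ∃ T', SkewHankelMove T₁ T' ∧ T' ∈ skewHankelClass R ∧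
        discrepancy T' T₂ < discrepancy T₁ T₂
    · obtain ⟨T', hmove, hT', hlt⟩ := c₁
      have hpos := discrepancy_nonneg hT'.1 h₂.1
      exact (ih _ (by omega) T' T₂ hT' h₂ rfl).head ⟨hmove, hT'⟩
    by_cases c₂ : ∃ T', SkewHankelMove T₂ T' ∧ T' ∈ skewHankelClass R ∧
        discrepancy T' T₁ < discrepancy T₂ T₁
    · obtain ⟨T', hmove, hT', hlt⟩ := c₂
      rw [discrepancy_comm T', discrepancy_comm T₂] at hlt
      have hpos := discrepancy_nonneg h₁.1 hT'.1
      exact (ih _ (by omega) T₁ T' h₁ hT' rfl).tail ⟨hmove.symm, h₂⟩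
    · rw [eq_of_forall_move_le h₁ h₂ c₁ c₂]
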